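/- Let $n\ge 0$ be an integer and $[n]=\{1,\dots,n\}$. The Shi arrangement $\mathcal S_n\subset\mathbb R^n$ is the union of the hyperplanes $x_i-x_j=0$ and $x_i-x_j=1$ for $1\le i<j\le n$; its regions are the connected components of $\mathbb R^n\setminus\mathcal S_n$. Let $R_0$ be the region $\{x : 0<x_i-x_j<1 \text{ for all } i<j\}$. The Pak–Stanley labeling $\lambda$ assigns to each region $R$ the function $\lambda(R)\colon[n]\to\mathbb N$ with $\lambda(R_0)=(1,\dots,1)$ such that, moving away from $R_0$, crossing a hyperplane $x_i=x_j$ ($i<j$) adds $1$ to the $j$-th coordinate and crossing a hyperplane $x_i=x_j+1$ ($i<j$) adds $1$ to the $i$-th coordinate; that is, $\lambda(R)_i$ equals $1$ plus the number of $j<i$ such that $x_j=x_i$ separates $R_0$ and $R$, plus the number of $j>i$ such that $x_i=x_j+1$ separates $R_0$ and $R$. A parking function of size $n$ is a function $f\colon[n]\to[n]$ with $|f^{-1}([k])|\ge k$ for every $k\in[n]$. Then $\lambda$ is injective on the set of regions of $\mathcal S_n$, and it is a bijection from the set of regions of $\mathcal S_n$ onto the set of parking functions of size $n$. -/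

import Mathlib

/-- The affine hyperplane `x_i - x_j = c` of `ℝⁿ`. -/
def diffHyperplane {n : ℕ} (i j : Fin n) (c : ℝ) : Set (Fin n → ℝ) :=
  {x | x i - x j = c}

/-- The Shi arrangement of order `n`, as a subset of `ℝⁿ`: the union of the hyperplanes
`x_i - x_j = 0` and `x_i - x_j = 1` for `i < j`. -/
def shiArrangement (n : ℕ) : Set (Fin n → ℝ) :=
  ⋃ (i : Fin n) (j : Fin n) (_ : i < j), diffHyperplane i j 0 ∪ diffHyperplane i j 1

/-- The regions of the Shi arrangement: the connected components of its complement in `ℝⁿ`. -/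
def shiRegions (n : ℕ) : Set (Set (Fin n → ℝ)) :=
  {R | ∃ x ∈ (shiArrangement n)ᶜ, R = connectedComponentIn (shiArrangement n)ᶜ x}

/-- The base region `R₀`: all `x` with `0 < x_i - x_j < 1` whenever `i < j`. -/
def shiBaseRegion (n : ℕ) : Set (Fin n → ℝ) :=
  {x | ∀ i j : Fin n, i < j → 0 < x i - x j ∧ x i - x j < 1}

/-- The hyperplane `x_i - x_j = c` separates `R` and `R'`: these sets lie in opposite open
half-spaces bounded by it. -/
def DiffSeparates {n : ℕ} (i j : Fin n) (c : ℝ) (R R' : Set (Fin n → ℝ)) : Prop :=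
  ((∀ x ∈ R, x i - x j < c) ∧ (∀ x ∈ R', c < x i - x j)) ∨
  ((∀ x ∈ R, c < x i - x j) ∧ (∀ x ∈ R', x i - x j < c))

/-- The Pak-Stanley label of a region `R`. The label of `R₀` is `(1, …, 1)`; moving away from
`R₀`, each crossing of a hyperplane `x_j = x_i` with `j < i` adds `1` to the coordinate `i`, and
each crossing of a hyperplane `x_i = x_j + 1` with `i < j` adds `1` to the coordinate `i`. So the
coordinate `i` is one more than the number of these hyperplanes that separate `R₀` and `R`. -/
noncomputable def pakStanleyLabel {n : ℕ} (R : Set (Fin n → ℝ)) : Fin n → ℕ := fun i =>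
  1 + {j : Fin n | j < i ∧ DiffSeparates j i 0 (shiBaseRegion n) R}.ncard
    + {j : Fin n | i < j ∧ DiffSeparates i j 1 (shiBaseRegion n) R}.ncard

/-- Parking functions of size `n`, with values in `{1, …, n}`:
for every `k` in `{1, …, n}`, at least `k` arguments have a value in `{1, …, k}`. -/
def IsParkingFunction {n : ℕ} (f : Fin n → ℕ) : Prop :=
  (∀ i, f i ∈ Finset.Icc 1 n) ∧
  ∀ k ∈ Finset.Icc 1 n, k ≤ {i : Fin n | f i ∈ Finset.Icc 1 k}.ncard

/-!
Let `x` be a point off the Shi arrangement, in a region `R`. The base region has decreasing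
coordinates with gaps less than `1`, so the `i`-th label of `R` is one more than the number of `j`
such that `j < i` and `x j < x i`, or `i < j` and `x j + 1 < x i`. Read the real line as time: at time
`x j` the index `j` sends a message to every larger index, and at time `x j + 1` it sends one to
every smaller index. The label of `i` is one more than the number of messages `i` has received by
time `x i` (`arrivals`, `pakStanleyLabel_connectedComponentIn`). At most one message comes from each
`j` with `x j < x i`, so the label is at most the rank of `i` in the order of the coordinates, and
the label is a parking function (`isParkingFunction_card_arrivals`).

The label determines the order of events. Suppose that `x` and `y` have the same labels and that
the messages up to the placement of a set `F` of indices agree. Among the remaining indices the next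
one to be placed must have received exactly its quota of messages, and no index may exceed its quota
before it is placed; comparing the candidates of `x` and of `y` shows that they coincide
(`next_index_eq`). By induction all messages agree (`arrivals_eq_of_card_eq`). The points of given
comparisons form a convex set, so `x` and `y` lie in the same region.

Conversely, given a parking function, let time run. If some index that has not been placed has
received its quota, place the largest such index now: its first messages only reach indices with
room left. Otherwise advance the clock past the next delayed message. The clock cannot run out of
delayed messages: then every placed index would have sent a message to every index not placed, none
of which would have received its quota, and too few values of the function would be at most
`#F + 1` (`PartialPlacement.exists_saturated`). When all indices are placed, the resulting point lies
off the arrangement and has the prescribed label.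
-/

/-- The indices `j ∈ F` whose message has reached `i` before time `t`, where `j` sends a message to
the larger indices at time `x j` and to the smaller indices at time `x j + 1`. -/
noncomputable def arrivals {n : ℕ} (F : Finset (Fin n)) (x : Fin n → ℝ) (t : ℝ) (i : Fin n) :
    Finset (Fin n) :=
  open Classical in F.filter fun j => (j < i ∧ x j < t) ∨ (i < j ∧ x j + 1 < t)

theorem mem_arrivals {n : ℕ} {F : Finset (Fin n)} {x : Fin n → ℝ} {t : ℝ} {i j : Fin n} :
    j ∈ arrivals F x t i ↔ j ∈ F ∧ ((j < i ∧ x j < t) ∨ (i < j ∧ x j + 1 < t)) := by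
  classical
  simp [arrivals]

theorem mem_arrivals_univ {n : ℕ} {x : Fin n → ℝ} {t : ℝ} {i j : Fin n} :
    j ∈ arrivals Finset.univ x t i ↔ (j < i ∧ x j < t) ∨ (i < j ∧ x j + 1 < t) := by
  simp [mem_arrivals]

theorem lt_of_mem_arrivals {n : ℕ} {F : Finset (Fin n)} {x : Fin n → ℝ} {t : ℝ} {i j : Fin n}
    (h : j ∈ arrivals F x t i) : x j < t := by
  rcases (mem_arrivals.1 h).2 with h | h <;> linarith [h.2]

/-! ### Points and regions -/

theorem mem_compl_shiArrangement {n : ℕ} {x : Fin n → ℝ} :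
    x ∈ (shiArrangement n)ᶜ ↔ ∀ i j : Fin n, i < j → x i - x j ≠ 0 ∧ x i - x j ≠ 1 := by
  simp [shiArrangement, diffHyperplane]

theorem injective_of_mem_compl_shiArrangement {n : ℕ} {x : Fin n → ℝ}
    (hx : x ∈ (shiArrangement n)ᶜ) : Function.Injective x := by
  rw [mem_compl_shiArrangement] at hx
  intro i j hij
  rcases lt_trichotomy i j with h | h | h
  · exact absurd (sub_eq_zero.2 hij) (hx i j h).1
  · exact h
  · exact absurd (sub_eq_zero.2 hij.symm) (hx j i h).1

theorem shiBaseRegion_nonempty (n : ℕ) : (shiBaseRegion n).Nonempty := by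
  refine ⟨fun i => -((i : ℕ) : ℝ) / (n + 1), fun i j hij => ?_⟩
  have hn : (0 : ℝ) < n + 1 := by positivity
  have h1 : ((i : ℕ) : ℝ) < (j : ℕ) := by exact_mod_cast hij
  have h2 : ((j : ℕ) : ℝ) < n := by exact_mod_cast j.2
  have h3 : (0 : ℝ) ≤ (i : ℕ) := by positivity
  have h4 : -((i : ℕ) : ℝ) / (n + 1) - -((j : ℕ) : ℝ) / (n + 1)
      = ((j : ℕ) - (i : ℕ) : ℝ) / (n + 1) := by ring
  rw [h4, lt_div_iff₀ hn, div_lt_one hn]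
  constructor <;> linarith

theorem IsPreconnected.pos_of_pos {X : Type*} [TopologicalSpace X] {s : Set X}
    (hs : IsPreconnected s) {g : X → ℝ} (hg : ContinuousOn g s) (h0 : ∀ z ∈ s, g z ≠ 0)
    {x z : X} (hx : x ∈ s) (hz : z ∈ s) (hpos : 0 < g x) : 0 < g z := by
  by_contra hneg
  obtain ⟨w, hw, hw0⟩ := hs.intermediate_value hz hx hg ⟨not_lt.1 hneg, hpos.le⟩
  exact h0 w hw hw0

theorem sub_lt_iff_of_mem_connectedComponentIn {n : ℕ} {x z : Fin n → ℝ}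
    (hx : x ∈ (shiArrangement n)ᶜ) (hz : z ∈ connectedComponentIn (shiArrangement n)ᶜ x)
    {i j : Fin n} (hij : i < j) {c : ℝ} (hc : c = 0 ∨ c = 1) :
    (z i - z j < c ↔ x i - x j < c) ∧ (c < z i - z j ↔ c < x i - x j) := by
  have hxR := mem_connectedComponentIn hx
  have hR : IsPreconnected (connectedComponentIn (shiArrangement n)ᶜ x) :=
    isPreconnected_connectedComponentIn
  have h0 : ∀ w ∈ connectedComponentIn (shiArrangement n)ᶜ x, w i - w j ≠ c := by
    intro w hw
    have := mem_compl_shiArrangement.1 (connectedComponentIn_subset _ _ hw) i j hij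
    rcases hc with rfl | rfl
    exacts [this.1, this.2]
  have hpos : ∀ a ∈ connectedComponentIn (shiArrangement n)ᶜ x,
      ∀ b ∈ connectedComponentIn (shiArrangement n)ᶜ x, c < a i - a j → c < b i - b j := by
    intro a ha b hb hab
    have := hR.pos_of_pos (g := fun w => w i - w j - c) (by fun_prop)
      (fun w hw => sub_ne_zero.2 (h0 w hw)) ha hb (sub_pos.2 hab)
    exact sub_pos.1 this
  have hgt : c < z i - z j ↔ c < x i - x j := ⟨hpos z hz x hxR, hpos x hxR z hz⟩
  refine ⟨?_, hgt⟩
  rw [lt_iff_le_and_ne, lt_iff_le_and_ne, ← not_lt, ← not_lt, hgt]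
  simp [h0 z hz, h0 x hxR]

theorem diffSeparates_zero_iff {n : ℕ} {x : Fin n → ℝ} (hx : x ∈ (shiArrangement n)ᶜ)
    {i j : Fin n} (hij : i < j) :
    DiffSeparates i j 0 (shiBaseRegion n) (connectedComponentIn (shiArrangement n)ᶜ x) ↔
      x i < x j := by
  constructor
  · rintro (⟨h, -⟩ | ⟨-, h⟩)
    · obtain ⟨w, hw⟩ := shiBaseRegion_nonempty n
      linarith [h w hw, (hw i j hij).1]
    · linarith [h x (mem_connectedComponentIn hx)]
  · exact fun h => Or.inr ⟨fun w hw => (hw i j hij).1, fun z hz =>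
      (sub_lt_iff_of_mem_connectedComponentIn hx hz hij (Or.inl rfl)).1.2 (by linarith)⟩

theorem diffSeparates_one_iff {n : ℕ} {x : Fin n → ℝ} (hx : x ∈ (shiArrangement n)ᶜ)
    {i j : Fin n} (hij : i < j) :
    DiffSeparates i j 1 (shiBaseRegion n) (connectedComponentIn (shiArrangement n)ᶜ x) ↔
      x j + 1 < x i := by
  constructor
  · rintro (⟨-, h⟩ | ⟨h, -⟩)
    · linarith [h x (mem_connectedComponentIn hx)]
    · obtain ⟨w, hw⟩ := shiBaseRegion_nonempty n
      linarith [h w hw, (hw i j hij).2]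
  · exact fun h => Or.inl ⟨fun w hw => (hw i j hij).2, fun z hz =>
      (sub_lt_iff_of_mem_connectedComponentIn hx hz hij (Or.inr rfl)).2.2 (by linarith)⟩

theorem pakStanleyLabel_connectedComponentIn {n : ℕ} {x : Fin n → ℝ}
    (hx : x ∈ (shiArrangement n)ᶜ) :
    pakStanleyLabel (connectedComponentIn (shiArrangement n)ᶜ x) =
      fun i => 1 + (arrivals Finset.univ x (x i) i).card := by
  funext i
  have hunion : (arrivals Finset.univ x (x i) i : Set (Fin n)) =
      {j : Fin n | j < i ∧ DiffSeparates j i 0 (shiBaseRegion n)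
        (connectedComponentIn (shiArrangement n)ᶜ x)} ∪
      {j : Fin n | i < j ∧ DiffSeparates i j 1 (shiBaseRegion n)
        (connectedComponentIn (shiArrangement n)ᶜ x)} := by
    ext j
    simp only [Finset.mem_coe, mem_arrivals_univ, Set.mem_union, Set.mem_ofPred_eq]
    exact or_congr (and_congr_right fun h => (diffSeparates_zero_iff hx h).symm)
      (and_congr_right fun h => (diffSeparates_one_iff hx h).symm)
  rw [← Set.ncard_coe_finset, hunion, Set.ncard_union_eq, ← add_assoc]
  · rfl
  · exact Set.disjoint_left.2 fun j h h' => lt_asymm h.1 h'.1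

/-- Points with the same comparisons lie in the same region, because the points with given
comparisons form a convex set. -/
theorem connectedComponentIn_eq_of_arrivals_eq {n : ℕ} {x y : Fin n → ℝ}
    (hx : x ∈ (shiArrangement n)ᶜ) (hy : y ∈ (shiArrangement n)ᶜ)
    (h : ∀ i, arrivals Finset.univ x (x i) i = arrivals Finset.univ y (y i) i) :
    connectedComponentIn (shiArrangement n)ᶜ x = connectedComponentIn (shiArrangement n)ᶜ y := by
  have hx' := mem_compl_shiArrangement.1 hx
  have hy' := mem_compl_shiArrangement.1 hy
  have h0 : ∀ i j : Fin n, i < j → (x i < x j ↔ y i < y j) := by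
    intro i j hij
    have := Finset.ext_iff.1 (h j) i
    simpa [mem_arrivals_univ, hij, hij.not_gt] using this
  have h1 : ∀ i j : Fin n, i < j → (x j + 1 < x i ↔ y j + 1 < y i) := by
    intro i j hij
    have := Finset.ext_iff.1 (h i) j
    simpa [mem_arrivals_univ, hij, hij.not_gt] using this
  have hseg : segment ℝ x y ⊆ (shiArrangement n)ᶜ := by
    rintro z ⟨a, b, ha, hb, hab, rfl⟩
    -- A convex combination of two reals on the same side of `c` stays on that side.
    have key : ∀ u v c : ℝ, u ≠ c → v ≠ c → (u < c ↔ v < c) → a * u + b * v ≠ c := by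
      intro u v c hu hv huv
      have hc : c = a * c + b * c := by rw [← add_mul, hab, one_mul]
      rcases lt_or_gt_of_ne hu with hlt | hgt
      · have hv' := huv.1 hlt
        rcases ha.eq_or_lt with rfl | ha
        · have : b = 1 := by linarith
          subst this; linarith
        · nlinarith [mul_lt_mul_of_pos_left hlt ha, mul_le_mul_of_nonneg_left hv'.le hb]
      · have hv' : c < v := lt_of_le_of_ne (not_lt.1 fun h => hgt.not_gt (huv.2 h)) hv.symm
        rcases ha.eq_or_lt with rfl | ha
        · have : b = 1 := by linarith
          subst this; linarith
        · nlinarith [mul_lt_mul_of_pos_left hgt ha, mul_le_mul_of_nonneg_left hv'.le hb]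
    refine mem_compl_shiArrangement.2 fun i j hij => ?_
    have e : (a • x + b • y) i - (a • x + b • y) j = a * (x i - x j) + b * (y i - y j) := by
      simp only [Pi.add_apply, Pi.smul_apply, smul_eq_mul]; ring
    rw [e]
    refine ⟨key _ _ _ (hx' i j hij).1 (hy' i j hij).1 ?_,
      key _ _ _ (hx' i j hij).2 (hy' i j hij).2 ?_⟩
    · rw [sub_neg, sub_neg]; exact h0 i j hij
    · have e1 : x i - x j < 1 ↔ ¬ (x j + 1 < x i) :=
        ⟨fun h => by linarith, fun h => lt_of_le_of_ne (by linarith) (hx' i j hij).2⟩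
      have e2 : y i - y j < 1 ↔ ¬ (y j + 1 < y i) :=
        ⟨fun h => by linarith, fun h => lt_of_le_of_ne (by linarith) (hy' i j hij).2⟩
      rw [e1, e2, h1 i j hij]
  exact connectedComponentIn_eq ((convex_segment x y).isPreconnected.subset_connectedComponentIn
    (left_mem_segment ℝ x y) hseg (right_mem_segment ℝ x y))

/-! ### Labels are parking functions -/

/-- The label of `i` is at most the rank of `x i` among the coordinates. -/
theorem isParkingFunction_card_arrivals {n : ℕ} {x : Fin n → ℝ} (hx : Function.Injective x) :
    IsParkingFunction fun i => 1 + (arrivals Finset.univ x (x i) i).card := by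
  classical
  let rank : Fin n → Fin n := fun i => ⟨(Finset.univ.filter fun j => x j < x i).card, by
    have : (Finset.univ.filter fun j => x j < x i) ⊂ Finset.univ :=
      Finset.filter_ssubset.2 ⟨i, Finset.mem_univ i, lt_irrefl _⟩
    simpa using Finset.card_lt_card this⟩
  have hle : ∀ i, (arrivals Finset.univ x (x i) i).card ≤ rank i := fun i =>
    Finset.card_le_card (t := Finset.univ.filter fun j => x j < x i) fun j hj =>
      Finset.mem_filter.2 ⟨Finset.mem_univ j, lt_of_mem_arrivals hj⟩
  have hmono : ∀ i j, x i < x j → rank i < rank j := by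
    intro i j hij
    refine Fin.lt_def.2 (Finset.card_lt_card (s := Finset.univ.filter fun l => x l < x i)
      (t := Finset.univ.filter fun l => x l < x j) ⟨fun l hl => ?_, fun hsub => ?_⟩)
    · simp only [Finset.mem_filter, Finset.mem_univ, true_and] at hl ⊢
      exact hl.trans hij
    · have : i ∈ Finset.univ.filter fun l => x l < x i := hsub (by simpa using hij)
      simp at this
  have hinj : Function.Injective rank := by
    intro i j hij
    by_contra hne
    rcases lt_or_gt_of_ne (hx.ne hne) with h | h
    · exact (hmono _ _ h).ne hij
    · exact (hmono _ _ h).ne hij.symm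
  let e : Fin n ≃ Fin n := Equiv.ofBijective rank (Finite.injective_iff_bijective.1 hinj)
  refine ⟨fun i => ?_, fun k hk => ?_⟩
  · have h1 := hle i
    have h2 := (rank i).2
    simp only [Finset.mem_Icc]
    omega
  · have hk' := (Finset.mem_Icc.1 hk).2
    let g : Fin k → Fin n := fun a => e.symm (Fin.castLE hk' a)
    have hg : Function.Injective g := e.symm.injective.comp (Fin.castLE_injective hk')
    have hsub : Set.range g ⊆ {i : Fin n |
        (fun i => 1 + (arrivals Finset.univ x (x i) i).card) i ∈ Finset.Icc 1 k} := by
      rintro _ ⟨a, rfl⟩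
      have h1 := hle (g a)
      have h2 : rank (g a) = Fin.castLE hk' a := e.apply_symm_apply _
      rw [h2, Fin.val_castLE] at h1
      have h3 := a.2
      simp only [Set.mem_ofPred_eq, Finset.mem_Icc]
      omega
    calc k = (Set.range g).ncard := by
          rw [← Set.image_univ, Set.ncard_image_of_injective _ hg]; simp
      _ ≤ _ := Set.ncard_le_ncard hsub (Set.toFinite _)

/-! ### The label determines the region -/

/-- Let `F` be an initial segment of the indices for both `x` and `y`, let `m` be the index placed
next by `x` and `m'` the one placed next by `y`. If the delayed messages from `F` that `x` sends
before placing `m` are among those that `y` sends before placing `m'`, then equality of labels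
forces `m = m'`. -/
theorem next_index_eq {n : ℕ} {x y : Fin n → ℝ} (hx : Function.Injective x)
    (hy : Function.Injective y)
    (hcard : ∀ i, (arrivals Finset.univ x (x i) i).card = (arrivals Finset.univ y (y i) i).card)
    {F : Finset (Fin n)} (hFx : ∀ j ∈ F, ∀ i ∉ F, x j < x i) (hFy : ∀ j ∈ F, ∀ i ∉ F, y j < y i)
    {m m' : Fin n} (hm : m ∉ F) (hm' : m' ∉ F) (hmin : ∀ i ∉ F, x m ≤ x i)
    (hmin' : ∀ i ∉ F, y m' ≤ y i) (hP : ∀ j ∈ F, x j + 1 < x m → y j + 1 < y m') :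
    m = m' ∧ arrivals Finset.univ x (x m) m = arrivals Finset.univ y (y m) m := by
  have hxF : ∀ j, x j < x m → j ∈ F := fun j hj => by
    by_contra h; exact (hmin j h).not_gt hj
  have hyF : ∀ j, y j < y m' → j ∈ F := fun j hj => by
    by_contra h; exact (hmin' j h).not_gt hj
  have hEq : arrivals Finset.univ x (x m) m = arrivals Finset.univ y (y m) m := by
    refine Finset.eq_of_subset_of_card_le (fun j hj => ?_) (hcard m).ge
    have hjF := hxF j (lt_of_mem_arrivals hj)
    rcases mem_arrivals_univ.1 hj with h | h
    · exact mem_arrivals_univ.2 (Or.inl ⟨h.1, hFy j hjF m hm⟩)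
    · exact mem_arrivals_univ.2 (Or.inr ⟨h.1, (hP j hjF h.2).trans_le (hmin' m hm)⟩)
  refine ⟨?_, hEq⟩
  rcases lt_trichotomy m m' with hlt | heq | hgt
  · exfalso
    have hEq' : arrivals Finset.univ y (y m') m' = arrivals Finset.univ x (x m') m' := by
      refine Finset.eq_of_subset_of_card_le (fun j hj => ?_) (hcard m').le
      have hjF := hyF j (lt_of_mem_arrivals hj)
      rcases mem_arrivals_univ.1 hj with h | h
      · exact mem_arrivals_univ.2 (Or.inl ⟨h.1, hFx j hjF m' hm'⟩)
      · have hjm : j ∈ arrivals Finset.univ x (x m) m := by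
          rw [hEq]
          exact mem_arrivals_univ.2 (Or.inr ⟨hlt.trans h.1, h.2.trans_le (hmin' m hm)⟩)
        rcases mem_arrivals_univ.1 hjm with h' | h'
        · exact absurd h'.1 (hlt.trans h.1).not_gt
        · exact mem_arrivals_univ.2 (Or.inr ⟨h.1, h'.2.trans_le (hmin m' hm')⟩)
    have hlt' : x m < x m' := lt_of_le_of_ne (hmin m' hm') (hx.ne hlt.ne)
    have : m ∈ arrivals Finset.univ y (y m') m' := by
      rw [hEq']; exact mem_arrivals_univ.2 (Or.inl ⟨hlt, hlt'⟩)
    exact hm (hyF m (lt_of_mem_arrivals this))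
  · exact heq
  · exfalso
    have hlt' : y m' < y m := lt_of_le_of_ne (hmin' m hm) (hy.ne hgt.ne)
    have : m' ∈ arrivals Finset.univ x (x m) m := by
      rw [hEq]; exact mem_arrivals_univ.2 (Or.inl ⟨hgt, hlt'⟩)
    exact hm' (hxF m' (lt_of_mem_arrivals this))

theorem arrivals_eq_of_card_eq {n : ℕ} {x y : Fin n → ℝ} (hx : Function.Injective x)
    (hy : Function.Injective y)
    (hcard : ∀ i, (arrivals Finset.univ x (x i) i).card = (arrivals Finset.univ y (y i) i).card)
    (i : Fin n) : arrivals Finset.univ x (x i) i = arrivals Finset.univ y (y i) i := by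
  classical
  have main : ∀ k ≤ n, ∃ F : Finset (Fin n), F.card = k ∧ (∀ j ∈ F, ∀ i ∉ F, x j < x i) ∧
      (∀ j ∈ F, ∀ i ∉ F, y j < y i) ∧
      ∀ i ∈ F, arrivals Finset.univ x (x i) i = arrivals Finset.univ y (y i) i := by
    intro k
    induction k with
    | zero => exact fun _ => ⟨∅, by simp⟩
    | succ k ih =>
      intro hk
      obtain ⟨F, hF, hFx, hFy, hFe⟩ := ih (by omega)
      have hne : (Fᶜ).Nonempty := by
        rw [← Finset.card_pos, Finset.card_compl, Fintype.card_fin]; omega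
      obtain ⟨m, hm, hmin⟩ := Finset.exists_min_image Fᶜ x hne
      obtain ⟨m', hm', hmin'⟩ := Finset.exists_min_image Fᶜ y hne
      simp only [Finset.mem_compl] at hm hmin hm' hmin'
      have hstep : m = m' ∧ arrivals Finset.univ x (x m) m = arrivals Finset.univ y (y m) m := by
        by_cases hP : ∀ j ∈ F, x j + 1 < x m → y j + 1 < y m'
        · exact next_index_eq hx hy hcard hFx hFy hm hm' hmin hmin' hP
        by_cases hQ : ∀ j ∈ F, y j + 1 < y m' → x j + 1 < x m
        · obtain ⟨h1, h2⟩ := next_index_eq hy hx (fun i => (hcard i).symm) hFy hFx hm' hm hmin'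
            hmin hQ
          exact ⟨h1.symm, by rw [← h1, h2]⟩
        -- The delayed messages sent so far form initial segments of `F`, in the common order of
        -- `x` and `y` on `F`, so one of the two segments contains the other.
        exfalso
        push Not at hP hQ
        obtain ⟨a, ha, hax, hay⟩ := hP
        obtain ⟨b, hb, hby, hbx⟩ := hQ
        have hxab : x a < x b := by linarith
        have hyba : y b < y a := by linarith
        rcases lt_trichotomy a b with h | h | h
        · have : a ∈ arrivals Finset.univ y (y b) b := by
            rw [← hFe b hb]; exact mem_arrivals_univ.2 (Or.inl ⟨h, hxab⟩)
          exact lt_asymm hyba (lt_of_mem_arrivals this)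
        · exact absurd hxab (by simp [h])
        · have : b ∈ arrivals Finset.univ x (x a) a := by
            rw [hFe a ha]; exact mem_arrivals_univ.2 (Or.inl ⟨h, hyba⟩)
          exact lt_asymm hxab (lt_of_mem_arrivals this)
      obtain ⟨rfl, hE⟩ := hstep
      refine ⟨insert m F, by rw [Finset.card_insert_of_notMem hm, hF], ?_, ?_, ?_⟩
      · intro j hj i hi
        simp only [Finset.mem_insert, not_or] at hj hi
        rcases hj with rfl | hj
        · exact lt_of_le_of_ne (hmin i hi.2) (hx.ne (Ne.symm hi.1))
        · exact hFx j hj i hi.2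
      · intro j hj i hi
        simp only [Finset.mem_insert, not_or] at hj hi
        rcases hj with rfl | hj
        · exact lt_of_le_of_ne (hmin' i hi.2) (hy.ne (Ne.symm hi.1))
        · exact hFy j hj i hi.2
      · intro i hi
        rcases Finset.mem_insert.1 hi with rfl | hi
        · exact hE
        · exact hFe i hi
  obtain ⟨F, hF, -, -, hFe⟩ := main n le_rfl
  have : F = Finset.univ := Finset.card_eq_iff_eq_univ F |>.1 (by simpa using hF)
  exact hFe i (this ▸ Finset.mem_univ i)

/-! ### Every parking function is a label -/

/-- A stage of the construction of a point with label `f`: the indices in `F` have been placed,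
at positions `x` that avoid the hyperplanes, before the time `t`; the placed indices have received
their quota of messages when they were placed, and the others have not exceeded theirs. The values
of `x` outside `F` are irrelevant. -/
structure PartialPlacement {n : ℕ} (f : Fin n → ℕ) (F : Finset (Fin n)) (x : Fin n → ℝ) (t : ℝ) :
    Prop where
  lt : ∀ j ∈ F, x j < t
  add_one_ne : ∀ j ∈ F, x j + 1 ≠ t
  injOn : ∀ i ∈ F, ∀ j ∈ F, x i = x j → i = j
  ne_add_one : ∀ i ∈ F, ∀ j ∈ F, x i ≠ x j + 1
  placed : ∀ i ∈ F, f i = 1 + (arrivals F x (x i) i).card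
  unplaced : ∀ i ∉ F, 1 + (arrivals F x t i).card ≤ f i

theorem exists_gt_forall_notMem_Ioc (S : Finset ℝ) (t : ℝ) :
    ∃ t' > t, ∀ s ∈ S, t < s → t' < s := by
  have h : ∀ᶠ t' in nhdsWithin t (Set.Ioi t), ∀ s ∈ S, t < s → t' < s := by
    rw [Filter.eventually_all_finset]
    intro s _
    by_cases hs : t < s
    · filter_upwards [Ioo_mem_nhdsGT hs] with t' ht' _ using ht'.2
    · exact Filter.Eventually.of_forall fun t' h => absurd h hs
  obtain ⟨t', h1, h2⟩ := (h.and self_mem_nhdsWithin).exists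
  exact ⟨t', h2, h1⟩

/-- After the clock has advanced past some delayed messages, an index that has not been placed has
received exactly its quota. -/
theorem PartialPlacement.exists_saturated {n : ℕ} {f : Fin n → ℕ} (hf : IsParkingFunction f)
    {F : Finset (Fin n)} {x : Fin n → ℝ} (hF : F.card < n) {t : ℝ} (h : PartialPlacement f F x t) :
    ∃ t', PartialPlacement f F x t' ∧ ∃ i ∉ F, f i = 1 + (arrivals F x t' i).card := by
  classical
  -- Induction on the number of delayed messages still to be sent.
  induction hp : (F.filter fun j => t < x j + 1).card generalizing t with
  | zero =>
    refine ⟨t, h, ?_⟩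
    by_contra hno
    push Not at hno
    have hsent : ∀ j ∈ F, x j + 1 < t := fun j hj => by
      have := Finset.filter_eq_empty_iff.1 (Finset.card_eq_zero.1 hp) hj
      exact lt_of_le_of_ne (not_lt.1 this) (h.add_one_ne j hj)
    have hbig : ∀ i ∉ F, F.card + 1 < f i := by
      intro i hi
      have hall : arrivals F x t i = F := by
        ext j
        refine ⟨fun hj => (mem_arrivals.1 hj).1, fun hj => mem_arrivals.2 ⟨hj, ?_⟩⟩
        rcases lt_trichotomy j i with hji | rfl | hij
        · exact Or.inl ⟨hji, h.lt j hj⟩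
        · exact absurd hj hi
        · exact Or.inr ⟨hij, hsent j hj⟩
      have h1 := h.unplaced i hi
      have h2 := hno i hi
      rw [hall] at h1 h2
      omega
    have hpark := hf.2 (F.card + 1) (Finset.mem_Icc.2 ⟨by omega, by omega⟩)
    have hsub : {i : Fin n | f i ∈ Finset.Icc 1 (F.card + 1)} ⊆ (F : Set (Fin n)) := by
      intro i hi
      by_contra hiF
      have := hbig i hiF
      have hi' : f i ∈ Finset.Icc 1 (F.card + 1) := hi
      have := (Finset.mem_Icc.1 hi').2
      omega
    have := Set.ncard_le_ncard hsub (Set.toFinite _)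
    rw [Set.ncard_coe_finset] at this
    omega
  | succ p ih =>
    by_cases hsat : ∃ i ∉ F, f i = 1 + (arrivals F x t i).card
    · exact ⟨t, h, hsat⟩
    push Not at hsat
    obtain ⟨m, hm, hmin⟩ := Finset.exists_min_image (F.filter fun j => t < x j + 1) x
      (Finset.card_pos.1 (by omega))
    obtain ⟨hmF, hmt⟩ := Finset.mem_filter.1 hm
    obtain ⟨t', ht', hgap⟩ := exists_gt_forall_notMem_Ioc (F.image fun j => x j + 1) (x m + 1)
    have hgap' : ∀ j ∈ F, x m < x j → t' < x j + 1 := fun j hj hlt =>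
      hgap _ (Finset.mem_image_of_mem _ hj) (by linarith)
    -- The message of `m` is the only delayed one between the times `t` and `t'`.
    have hdich : ∀ j ∈ F, j ≠ m → x j + 1 < t ∨ t' < x j + 1 := by
      intro j hj hjm
      by_cases hjt : t < x j + 1
      · have := hmin j (Finset.mem_filter.2 ⟨hj, hjt⟩)
        exact Or.inr (hgap' j hj (lt_of_le_of_ne this fun he => hjm (h.injOn m hmF j hj he).symm))
      · exact Or.inl (lt_of_le_of_ne (not_lt.1 hjt) (h.add_one_ne j hj))
    refine ih (t := t') ⟨fun j hj => ?_, fun j hj => ?_, h.injOn, h.ne_add_one, h.placed,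
      fun i hi => ?_⟩ ?_
    · linarith [h.lt j hj]
    · by_cases hjm : j = m
      · subst hjm; exact ht'.ne
      · rcases hdich j hj hjm with h1 | h1
        · linarith
        · exact h1.ne'
    · have hsub : arrivals F x t' i ⊆ insert m (arrivals F x t i) := by
        intro j hj
        obtain ⟨hjF, hj⟩ := mem_arrivals.1 hj
        by_cases hjm : j = m
        · exact Finset.mem_insert.2 (Or.inl hjm)
        refine Finset.mem_insert_of_mem (mem_arrivals.2 ⟨hjF, ?_⟩)
        rcases hj with hj | hj
        · exact Or.inl ⟨hj.1, h.lt j hjF⟩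
        · exact Or.inr ⟨hj.1, (hdich j hjF hjm).resolve_right hj.2.not_gt⟩
      have h1 := (Finset.card_le_card hsub).trans (Finset.card_insert_le _ _)
      have h2 := h.unplaced i hi
      have h3 := hsat i hi
      omega
    · have : (F.filter fun j => t' < x j + 1) = (F.filter fun j => t < x j + 1).erase m := by
        ext j
        simp only [Finset.mem_filter, Finset.mem_erase]
        constructor
        · rintro ⟨hj, hlt⟩
          exact ⟨by rintro rfl; linarith, hj, by linarith⟩
        · rintro ⟨hjm, hj, hlt⟩
          exact ⟨hj, (hdich j hj hjm).resolve_left hlt.not_gt⟩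
      rw [this, Finset.card_erase_of_mem hm, hp, Nat.add_sub_cancel]

/-- The largest index that has received its quota can be placed. -/
theorem PartialPlacement.exists_insert {n : ℕ} {f : Fin n → ℕ} {F : Finset (Fin n)}
    {x : Fin n → ℝ} {t : ℝ} (h : PartialPlacement f F x t)
    (hsat : ∃ i ∉ F, f i = 1 + (arrivals F x t i).card) :
    ∃ m ∉ F, ∃ x' t', PartialPlacement f (insert m F) x' t' := by
  classical
  obtain ⟨i₀, hi₀, hi₀f⟩ := hsat
  obtain ⟨m, hm, hmax⟩ := Finset.exists_max_image
    (Fᶜ.filter fun i => f i = 1 + (arrivals F x t i).card) id ⟨i₀, by simp [hi₀, ← hi₀f]⟩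
  simp only [Finset.mem_filter, Finset.mem_compl, id, and_imp] at hm hmax
  obtain ⟨hmF, hmf⟩ := hm
  obtain ⟨t', ht', hgap⟩ :=
    exists_gt_forall_notMem_Ioc (insert (t + 1) (F.image fun j => x j + 1)) t
  have hgap1 : t' < t + 1 := hgap _ (Finset.mem_insert_self _ _) (by linarith)
  have hgap' : ∀ j ∈ F, t < x j + 1 → t' < x j + 1 := fun j hj hlt =>
    hgap _ (Finset.mem_insert_of_mem (Finset.mem_image_of_mem _ hj)) hlt
  have hne : ∀ j ∈ F, j ≠ m := fun j hj he => hmF (he ▸ hj)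
  have hxm : Function.update x m t m = t := Function.update_self _ _ _
  have hxF : ∀ j ∈ F, Function.update x m t j = x j := fun j hj =>
    Function.update_of_ne (hne j hj) _ _
  refine ⟨m, hmF, Function.update x m t, t', ⟨?_, ?_, ?_, ?_, ?_, ?_⟩⟩
  · intro j hj
    rcases Finset.mem_insert.1 hj with rfl | hj
    · rwa [hxm]
    · rw [hxF j hj]; linarith [h.lt j hj]
  · intro j hj
    rcases Finset.mem_insert.1 hj with rfl | hj
    · rw [hxm]; exact hgap1.ne'
    · rw [hxF j hj]
      intro he
      rcases lt_or_gt_of_ne (h.add_one_ne j hj) with h1 | h1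
      · linarith
      · linarith [hgap' j hj h1]
  · intro i hi j hj he
    rcases Finset.mem_insert.1 hi with rfl | hi' <;> rcases Finset.mem_insert.1 hj with rfl | hj'
    · rfl
    · rw [hxm, hxF j hj'] at he; linarith [h.lt j hj']
    · rw [hxm, hxF i hi'] at he; linarith [h.lt i hi']
    · rw [hxF i hi', hxF j hj'] at he; exact h.injOn i hi' j hj' he
  · intro i hi j hj he
    rcases Finset.mem_insert.1 hi with rfl | hi' <;> rcases Finset.mem_insert.1 hj with rfl | hj'
    · linarith
    · rw [hxm, hxF j hj'] at he; exact h.add_one_ne j hj' he.symm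
    · rw [hxm, hxF i hi'] at he; linarith [h.lt i hi']
    · rw [hxF i hi', hxF j hj'] at he; exact h.ne_add_one i hi' j hj' he
  · intro i hi
    -- Up to time `t` the new index has sent no message.
    have hold : ∀ s ≤ t, arrivals (insert m F) (Function.update x m t) s i = arrivals F x s i := by
      intro s hs
      ext j
      rw [mem_arrivals, mem_arrivals, Finset.mem_insert]
      constructor
      · rintro ⟨rfl | hj, hj'⟩
        · rw [hxm] at hj'
          rcases hj' with hj' | hj' <;> linarith [hj'.2]
        · rw [hxF j hj] at hj'; exact ⟨hj, hj'⟩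
      · rintro ⟨hj, hj'⟩
        rw [hxF j hj]; exact ⟨Or.inr hj, hj'⟩
    rcases Finset.mem_insert.1 hi with rfl | hi
    · rw [hxm, hold t le_rfl, hmf]
    · rw [hxF i hi, hold _ (h.lt i hi).le]; exact h.placed i hi
  · intro i hi
    simp only [Finset.mem_insert, not_or] at hi
    have hdel : ∀ j ∈ F, x j + 1 < t' → x j + 1 < t := fun j hj hlt => by
      by_contra hge
      have := hgap' j hj (lt_of_le_of_ne (not_lt.1 hge) (h.add_one_ne j hj).symm)
      linarith
    have hsub : ∀ j ∈ arrivals (insert m F) (Function.update x m t) t' i, j ≠ m →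
        j ∈ arrivals F x t i := by
      intro j hj hjm
      obtain ⟨hjF, hj⟩ := mem_arrivals.1 hj
      have hjF := Finset.mem_of_mem_insert_of_ne hjF hjm
      rw [hxF j hjF] at hj
      refine mem_arrivals.2 ⟨hjF, ?_⟩
      rcases hj with hj | hj
      · exact Or.inl ⟨hj.1, h.lt j hjF⟩
      · exact Or.inr ⟨hj.1, hdel j hjF hj.2⟩
    have hi' := h.unplaced i hi.2
    rcases lt_or_gt_of_ne hi.1 with him | hmi
    · have : arrivals (insert m F) (Function.update x m t) t' i ⊆ arrivals F x t i := by
        intro j hj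
        refine hsub j hj ?_
        rintro rfl
        rcases (mem_arrivals.1 hj).2 with h' | h'
        · exact him.not_gt h'.1
        · rw [hxm] at h'; linarith [h'.2]
      have := Finset.card_le_card this
      omega
    · -- By maximality of `m`, the larger index `i` has room for one more message.
      have hstrict : f i ≠ 1 + (arrivals F x t i).card := fun he =>
        (hmax i hi.2 he).not_gt hmi
      have : arrivals (insert m F) (Function.update x m t) t' i ⊆
          insert m (arrivals F x t i) := fun j hj => by
        by_cases hjm : j = m
        · exact Finset.mem_insert.2 (Or.inl hjm)
        · exact Finset.mem_insert_of_mem (hsub j hj hjm)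
      have := (Finset.card_le_card this).trans (Finset.card_insert_le _ _)
      omega

theorem IsParkingFunction.exists_point {n : ℕ} {f : Fin n → ℕ} (hf : IsParkingFunction f) :
    ∃ x ∈ (shiArrangement n)ᶜ, ∀ i, f i = 1 + (arrivals Finset.univ x (x i) i).card := by
  classical
  have main : ∀ k ≤ n, ∃ F : Finset (Fin n), F.card = k ∧ ∃ x t, PartialPlacement f F x t := by
    intro k
    induction k with
    | zero =>
      refine fun _ => ⟨∅, rfl, 0, 0, by simp, by simp, by simp, by simp, by simp, fun i _ => ?_⟩
      simpa [arrivals] using (Finset.mem_Icc.1 (hf.1 i)).1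
    | succ k ih =>
      intro hk
      obtain ⟨F, hF, x, t, h⟩ := ih (by omega)
      obtain ⟨t', h', hsat⟩ := h.exists_saturated hf (by omega)
      obtain ⟨m, hm, x', t'', h''⟩ := h'.exists_insert hsat
      exact ⟨insert m F, by rw [Finset.card_insert_of_notMem hm, hF], x', t'', h''⟩
  obtain ⟨F, hF, x, t, h⟩ := main n le_rfl
  obtain rfl : F = Finset.univ := Finset.card_eq_iff_eq_univ F |>.1 (by simpa using hF)
  refine ⟨x, mem_compl_shiArrangement.2 fun i j hij => ⟨fun he => ?_, fun he => ?_⟩,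
    fun i => h.placed i (Finset.mem_univ i)⟩
  · exact hij.ne (h.injOn i (Finset.mem_univ i) j (Finset.mem_univ j) (sub_eq_zero.1 he))
  · exact h.ne_add_one i (Finset.mem_univ i) j (Finset.mem_univ j) (by linarith)

theorem proposition3p8 (n : ℕ) :
    Set.InjOn (pakStanleyLabel (n := n)) (shiRegions n) ∧
      Set.BijOn (pakStanleyLabel (n := n)) (shiRegions n)
        {f : Fin n → ℕ | IsParkingFunction f} := by
  have hinj : Set.InjOn (pakStanleyLabel (n := n)) (shiRegions n) := by
    rintro _ ⟨x, hx, rfl⟩ _ ⟨y, hy, rfl⟩ hxy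
    rw [pakStanleyLabel_connectedComponentIn hx, pakStanleyLabel_connectedComponentIn hy] at hxy
    exact connectedComponentIn_eq_of_arrivals_eq hx hy <| arrivals_eq_of_card_eq
      (injective_of_mem_compl_shiArrangement hx) (injective_of_mem_compl_shiArrangement hy)
      fun i => Nat.add_left_cancel (congrFun hxy i)
  refine ⟨hinj, ?_, hinj, ?_⟩
  · rintro _ ⟨x, hx, rfl⟩
    rw [pakStanleyLabel_connectedComponentIn hx]
    exact isParkingFunction_card_arrivals (injective_of_mem_compl_shiArrangement hx)
  · intro f hf
    obtain ⟨x, hx, hfx⟩ := IsParkingFunction.exists_point hf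
    refine ⟨_, ⟨x, hx, rfl⟩, ?_⟩
    rw [pakStanleyLabel_connectedComponentIn hx]
    exact funext fun i => (hfx i).symm
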